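/- **Setting.** A *physical system* consists of a nonempty set $\mathcal O$ of observables, a set $\mathcal S$ of states containing a distinguished null state $0$ and at least one other element, for each $\rho\in\mathcal S$ and $A\in\mathcal O$ a Borel measure $P_\rho^A=P_\rho(\,\cdot\,;A)$ on $\mathbb R$ (a probability measure if $\rho\neq 0$, the zero measure if $\rho=0$), and for each Borel set $\Delta$ and $A\in\mathcal O$ an update map $T_{(\Delta;A)}:\mathcal S\to\mathcal S$ with $T_{(\emptyset;A)}(\rho)=0$ and $T_{(\Delta;A)}(0)=0$. Below, "state" means non-null state, $0/0=0$, and $\alpha$ abbreviates $\{\alpha\}$ in $P$ and $T$. The *spectrum* $\sigma(A)$ is the intersection of all Borel sets $\Delta$ with $P_\rho(\Delta;A)=1$ for all states $\rho$. The system is assumed to be *finite-dimensional*: each $\sigma(A)$ is finite and has probability one in every state, and $n=\sup_A|\sigma(A)|<\infty$. $A$ is *nondegenerate* if $|\sigma(A)|=n$. For $f:\sigma(A)\to\sigma(B)$ write $B=f(A)$ if $P_\rho(\Sigma;B)=P_\rho(f^{-1}(\Sigma);A)$ for all states $\rho$ and all $\Sigma\subset\sigma(B)$. Observables $A,B$ are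 *compatible* if $A=f(C)$, $B=g(C)$ for some $C,f,g$. The probability of a sequence of events is $$P_\rho\big((\Delta_1;A_1),\dots,(\Delta_m;A_m)\big)=\prod_{i=1}^m P_{\rho_{i-1}}(\Delta_i;A_i),\qquad \rho_0=\rho,\ \ \rho_i=T_{(\Delta_i;A_i)}(\rho_{i-1}),$$ and $p_\rho(\alpha_1,\dots,\alpha_m;A_1,\dots,A_m)$ denotes this number for $\Delta_i=\{\alpha_i\}$. A *completely mixed state* is a state $\omega$ with $P_\omega(\alpha;A)=1/n$ for all nondegenerate $A$ and $\alpha\in\sigma(A)$. A *rank-one projection* is an observable $E=\chi_{\{\alpha\}}(A)$ with $A$ nondegenerate and $\alpha\in\sigma(A)$; a *pure state* is a state $T_{(1;E)}(\omega)$ with $E$ a rank-one projection. For $E=\chi_\Delta(C)$ and $F=\chi_\Sigma(C)$ put $E\circ F=\chi_{\Delta\cap\Sigma}(C)$. The system is assumed to satisfy the following postulates (all events $(\Delta;A)$ have $\Delta\subset\sigma(A)$). 1. *Separability.* If $P_\rho^A=P_\rho^B$ for all states $\rho$, then $A=B$; if $P_\rho^A=P_{\rho'}^A$ for all observables $A$,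 then $\rho=\rho'$. 2. *Subjective update.* The (non-null) states form a convex set on which $\rho\mapsto P_\rho$ preserves convex combinations, and for every event $(\Delta;A)$, every state $\rho$ and every nonempty sequence $s$ of events, $P_{T_{(\Delta;A)}(\rho)}(s)=\sum_{\alpha\in\Delta}\frac{P_\rho(\alpha;A)}{P_\rho(\Delta;A)}P_{T_{(\alpha;A)}(\rho)}(s)$. 3. *Self-compatibility.* For $\alpha,\alpha'\in\sigma(A)$ and $\Delta\subset\sigma(A)$: $P_{T_{(\alpha;A)}(\rho)}(\Delta;A)=P_\rho(\Delta\cap\{\alpha\};A)/P_\rho(\alpha;A)$ for every state $\rho$, and $T_{(\alpha;A)}\circ T_{(\alpha';A)}$ is $T_{(\alpha;A)}$ if $\alpha=\alpha'$ and the null map otherwise. 4. *Observables and states.* Each degenerate observable is $f(C)$ for a nondegenerate $C$ and a non-injective $f$; for nondegenerate $A$ and every real function $f$ on $\sigma(A)$ there is an observable $f(A)$; a completely mixed state $\omega$ exists, and every state is a convex combination of states obtained from $\omega$ by finitely many (possibly no) updates $T_{(\Delta;A)}$. 5. *Compatibility.* If $A=f(C)$ and $B=g(C)$, then $P_\rho((\Delta;A),(\Sigma;B))=P_\rho(f^{-1}(\Delta)\cap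 g^{-1}(\Sigma);C)$ for all states $\rho$, $\Delta\subset\sigma(A)$, $\Sigma\subset\sigma(B)$; and $T_{(\alpha;A)}\circ T_{(\beta;B)}=T_{(1;\chi_{\{\alpha\}}(A)\circ\chi_{\{\beta\}}(B))}$ for compatible $A,B$ and $\alpha\in\sigma(A)$, $\beta\in\sigma(B)$. 6. *Commutativity.* If $P_\rho(\Delta;A)P_{T_{(\Delta;A)}(\rho)}(\Sigma;B)=P_\rho(\Sigma;B)P_{T_{(\Sigma;B)}(\rho)}(\Delta;A)$ for all states $\rho$, $\Delta\subset\sigma(A)$ and $\Sigma\subset\sigma(B)$, then $A$ and $B$ are compatible. 7. *Eigenstates.* If $F$ is a rank-one projection and $P_{T_{(1;F)}(\omega)}(\alpha;A)=1$ for some $\alpha\in\sigma(A)$, then $F$ and $A$ are compatible; if $A$ is nondegenerate and $P_\rho(\alpha;A)=1$ for some $\alpha\in\sigma(A)$, then $\rho$ is pure. 8. *Symmetry of transition probabilities.* $P_{T_{(1;E)}(\omega)}(1;F)=P_{T_{(1;F)}(\omega)}(1;E)$ for all rank-one projections $E,F$. **Proposition (Local orthogonality).** For each $j\in\{1,\dots,k\}$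 let $(A^{(j)}_1,\dots,A^{(j)}_m)$ be a tuple of pairwise compatible observables and let $\alpha^{(j)}_i\in\sigma(A^{(j)}_i)$ for $i=1,\dots,m$. Suppose that for all distinct $j,j'\in\{1,\dots,k\}$ there is $i\in\{1,\dots,m\}$ with $A^{(j)}_i=A^{(j')}_i$ and $\alpha^{(j)}_i\neq\alpha^{(j')}_i$. Then for every state $\rho$, $$\sum_{j=1}^k p_\rho\big(\alpha^{(j)}_1,\dots,\alpha^{(j)}_m;A^{(j)}_1,\dots,A^{(j)}_m\big)\le 1 .$$ -/

import Mathlib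

open MeasureTheory
open scoped NNReal

/-- A physical system: observables, states (among them a null state without physical meaning),
for each state and observable a Borel measure on `ℝ` (a probability measure if the state is not
null, the null measure otherwise), and for each observable event `(Δ; A)` a state update.
The update is a function of an arbitrary set `Δ` of reals only for convenience: below it is used
at finite sets. -/
structure PhysicalSystem (Obs : Type*) (State : Type*) where
  /-- the null state -/
  null : State
  /-- `prob ρ A` is the measure `P_ρ( · ; A)` -/
  prob : State → Obs → Measure ℝ
  /-- `update Δ A` is the map `T_(Δ; A)` -/
  update : Set ℝ → Obs → State → State
  nonempty_obs : Nonempty Obs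
  exists_ne_null : ∃ ρ, ρ ≠ null
  prob_null : ∀ A, prob null A = 0
  isProbabilityMeasure_prob : ∀ ρ A, ρ ≠ null → IsProbabilityMeasure (prob ρ A)
  update_empty : ∀ A ρ, update ∅ A ρ = null
  update_null : ∀ Δ A, update Δ A null = null

namespace PhysicalSystem

section

variable {Obs State : Type*} (S : PhysicalSystem Obs State)

/-- The spectrum `σ(A)`: the intersection of all Borel sets that have probability one in every
(non-null) state. -/
def spectrum (A : Obs) : Set ℝ :=
  ⋂₀ {Δ | MeasurableSet Δ ∧ ∀ ρ, ρ ≠ S.null → S.prob ρ A Δ = 1}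

/-- The dimension: the supremum of the cardinalities of the spectra. -/
noncomputable def dim : ℕ∞ := ⨆ A, (S.spectrum A).encard

/-- Finite-dimensional systems: every spectrum is a finite set, and the dimension is finite. That
the values of an observable lie in its spectrum with probability one, which is part of the meaning
of the spectrum as the smallest set containing all possible values, does not follow from
`spectrum` being finite (the intersection above is empty for a diffuse measure), and is recorded. -/
structure IsFiniteDimensional : Prop where
  finite_spectrum : ∀ A, (S.spectrum A).Finite
  prob_spectrum : ∀ A ρ, ρ ≠ S.null → S.prob ρ A (S.spectrum A) = 1
  dim_lt_top : S.dim < ⊤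

/-- An observable is nondegenerate if its spectrum has `dim` elements. -/
def IsNondegenerate (A : Obs) : Prop := (S.spectrum A).encard = S.dim

/-! ### Sequential events -/

/-- The composite update `T_(Δₘ; Aₘ) ∘ ⋯ ∘ T_(Δ₁; A₁)` of a sequence of events. -/
def seqUpdate : List (Set ℝ × Obs) → State → State
  | [], ρ => ρ
  | e :: l, ρ => seqUpdate l (S.update e.1 e.2 ρ)

/-- The probability of a sequence of events `(Δ₁; A₁), …, (Δₘ; Aₘ)` in the state `ρ`: the product
over `i` of the probability of `(Δᵢ; Aᵢ)` in the state `T_(Δᵢ₋₁; Aᵢ₋₁) ⋯ T_(Δ₁; A₁) ρ`. -/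
noncomputable def seqProb : List (Set ℝ × Obs) → State → ℝ
  | [], _ => 1
  | e :: l, ρ => (S.prob ρ e.2).real e.1 * seqProb l (S.update e.1 e.2 ρ)

/-- The joint sequential probability `p_ρ(α₁, …, αₘ; A₁, …, Aₘ)`. -/
noncomputable def jointProb {m : ℕ} (ρ : State) (α : Fin m → ℝ) (A : Fin m → Obs) : ℝ :=
  S.seqProb (List.ofFn fun i => (({α i} : Set ℝ), A i)) ρ

/-! ### Functional relations, compatibility, commutativity -/

/-- `B = f(A)`: in every state the distribution of `B` on `σ(B)` is the pushforward of the
distribution of `A` on `σ(A)` along `f : σ(A) → σ(B)` (the values of `f` off `σ(A)` play no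
role). -/
def IsFunctionVia (f : ℝ → ℝ) (A B : Obs) : Prop :=
  Set.MapsTo f (S.spectrum A) (S.spectrum B) ∧
    ∀ ρ, ρ ≠ S.null → ∀ Γ ⊆ S.spectrum B,
      (S.prob ρ B).real Γ = (S.prob ρ A).real (S.spectrum A ∩ f ⁻¹' Γ)

/-- Two observables are compatible if they are functions of one observable. -/
def Compatible (A B : Obs) : Prop :=
  ∃ (C : Obs) (f g : ℝ → ℝ), S.IsFunctionVia f C A ∧ S.IsFunctionVia g C B

/-- Two observables commute if they satisfy the Bayes rule. -/
def Commutes (A B : Obs) : Prop :=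
  ∀ ρ, ρ ≠ S.null → ∀ Δ ⊆ S.spectrum A, ∀ Γ ⊆ S.spectrum B,
    (S.prob ρ A).real Δ * (S.prob (S.update Δ A ρ) B).real Γ =
      (S.prob ρ B).real Γ * (S.prob (S.update Γ B ρ) A).real Δ

/-! ### Projections -/

/-- `E = χ_Δ(A)`. -/
def IsChar (Δ : Set ℝ) (A E : Obs) : Prop :=
  Δ ⊆ S.spectrum A ∧ S.IsFunctionVia (Δ.indicator fun _ => 1) A E

/-- `E` is a projection of rank (trace) `k`: it is `χ_Δ(A)` for a nondegenerate `A` and a set `Δ`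
of `k` elements. -/
def IsProjectionOfRank (k : ℕ) (E : Obs) : Prop :=
  ∃ (A : Obs) (Δ : Set ℝ), S.IsNondegenerate A ∧ Δ.encard = k ∧ S.IsChar Δ A E

/-- `G = E ∘ F` for compatible projections `E`, `F`: if `E = χ_Δ(C)` and `F = χ_Γ(C)`, then
`E ∘ F = χ_(Δ ∩ Γ)(C)`. In the systems considered here the choice of `C` makes no difference. -/
def IsProduct (E F G : Obs) : Prop :=
  ∃ (C : Obs) (Δ Γ : Set ℝ), S.IsChar Δ C E ∧ S.IsChar Γ C F ∧ S.IsChar (Δ ∩ Γ) C G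

/-! ### Special states -/

/-- The completely mixed state: uniformly distributed on the spectrum of every nondegenerate
observable. -/
def IsCompletelyMixed (ω : State) : Prop :=
  ω ≠ S.null ∧ ∀ A, S.IsNondegenerate A → ∀ α ∈ S.spectrum A,
    (S.prob ω A).real {α} = 1 / ((S.spectrum A).ncard : ℝ)

/-- States obtained from `ω` by a (possibly empty) sequence of observable events. -/
def IsAccessibleFrom (ω ρ : State) : Prop :=
  ρ ≠ S.null ∧ ∃ l : List (Set ℝ × Obs),
    (∀ e ∈ l, e.1 ⊆ S.spectrum e.2) ∧ ρ = S.seqUpdate l ω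

/-- `ρ` is the convex combination `∑ i, w i • τ i` of non-null states. States are determined by the
probabilities that they assign, and these depend affinely on the state, so convex combinations of
states are expressed through their probability measures. -/
def IsConvexCombination {k : ℕ} (ρ : State) (w : Fin k → ℝ≥0) (τ : Fin k → State) : Prop :=
  ρ ≠ S.null ∧ (∀ i, τ i ≠ S.null) ∧ ∑ i, w i = 1 ∧
    ∀ A, S.prob ρ A = ∑ i, w i • S.prob (τ i) A

/-- Pure states: `T_(1; E) ω` for the completely mixed state `ω` and a rank-one projection `E`. -/
def IsPure (ρ : State) : Prop :=
  ∃ (ω : State) (E : Obs), S.IsCompletelyMixed ω ∧ S.IsProjectionOfRank 1 E ∧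
    ρ = S.update {1} E ω

/-! ### The postulates -/

/-- Observables that no state distinguishes are equal, and states that no observable distinguishes
are equal. -/
def Separability : Prop :=
  (∀ A B, (∀ ρ, ρ ≠ S.null → S.prob ρ A = S.prob ρ B) → A = B) ∧
    ∀ ρ ρ', (∀ A, S.prob ρ A = S.prob ρ' A) → ρ = ρ'

/-- The (non-null) states form a convex set on which `ρ ↦ P_ρ` is affine; and the update by the
event `(Δ; A)` acts on the probability of any sequence of events as the mixture of the updates by
the outcomes `α ∈ Δ`, weighted with their conditional probabilities given `Δ` (with `0 / 0 = 0`). -/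
def SubjectiveUpdate : Prop :=
  (∀ (k : ℕ) (w : Fin k → ℝ≥0) (τ : Fin k → State), (∀ i, τ i ≠ S.null) → ∑ i, w i = 1 →
      ∃ ρ, S.IsConvexCombination ρ w τ) ∧
    ∀ (A : Obs) (Δ : Finset ℝ), (Δ : Set ℝ) ⊆ S.spectrum A → ∀ ρ, ρ ≠ S.null →
      ∀ l : List (Set ℝ × Obs), l ≠ [] → (∀ e ∈ l, e.1 ⊆ S.spectrum e.2) →
        S.seqProb l (S.update Δ A ρ) =
          ∑ α ∈ Δ, (S.prob ρ A).real {α} / (S.prob ρ A).real Δ * S.seqProb l (S.update {α} A ρ)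

/-- Measuring `A` with outcome `α` conditions the distribution of `A` on `{α}` (with `0 / 0 = 0`),
and `T_(α; A) ∘ T_(α'; A)` is `T_(α; A)` if `α = α'` and the null map otherwise. -/
def SelfCompatibility : Prop :=
  ∀ A, ∀ α ∈ S.spectrum A,
    (∀ ρ, ρ ≠ S.null → ∀ Δ ⊆ S.spectrum A,
      (S.prob (S.update {α} A ρ) A).real Δ =
        (S.prob ρ A).real (Δ ∩ {α}) / (S.prob ρ A).real {α}) ∧
    (∀ ρ, S.update {α} A (S.update {α} A ρ) = S.update {α} A ρ) ∧
    ∀ α' ∈ S.spectrum A, α ≠ α' → ∀ ρ, S.update {α} A (S.update {α'} A ρ) = S.null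

/-- Every degenerate observable is a coarse-graining of a nondegenerate one, every function of a
nondegenerate observable is an observable, there is a completely mixed state, and every state is a
convex combination of states accessible from it. -/
def ObservablesAndStates : Prop :=
  (∀ A, ¬ S.IsNondegenerate A → ∃ (C : Obs) (f : ℝ → ℝ),
      S.IsNondegenerate C ∧ S.IsFunctionVia f C A ∧ ¬ Set.InjOn f (S.spectrum C)) ∧
    (∀ A, S.IsNondegenerate A → ∀ f : ℝ → ℝ, ∃ B, S.IsFunctionVia f A B) ∧
    ∃ ω, S.IsCompletelyMixed ω ∧
      ∀ ρ, ρ ≠ S.null → ∃ (k : ℕ) (w : Fin k → ℝ≥0) (τ : Fin k → State),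
        (∀ i, S.IsAccessibleFrom ω (τ i)) ∧ S.IsConvexCombination ρ w τ

/-- If `A = f(C)` and `B = g(C)`, the sequential measure of `(A, B)` is the pushforward of the
distribution of `C` along `(f, g)` (a measure on the finite set `σ(A) × σ(B)`, determined by its
values on boxes); and `T_(α; A) ∘ T_(β; B) = T_(1; E ∘ F)` with `E = χ_{α}(A)`, `F = χ_{β}(B)`. -/
def Compatibility : Prop :=
  (∀ (A B C : Obs) (f g : ℝ → ℝ), S.IsFunctionVia f C A → S.IsFunctionVia g C B →
      ∀ ρ, ρ ≠ S.null → ∀ Δ ⊆ S.spectrum A, ∀ Γ ⊆ S.spectrum B,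
        S.seqProb [(Δ, A), (Γ, B)] ρ =
          (S.prob ρ C).real (S.spectrum C ∩ (f ⁻¹' Δ ∩ g ⁻¹' Γ))) ∧
    ∀ A B, S.Compatible A B → ∀ α ∈ S.spectrum A, ∀ β ∈ S.spectrum B, ∀ E F G,
      S.IsChar {α} A E → S.IsChar {β} B F → S.IsProduct E F G →
        ∀ ρ, S.update {α} A (S.update {β} B ρ) = S.update {1} G ρ

/-- Only compatible observables commute. -/
def Commutativity : Prop :=
  ∀ A B, S.Commutes A B → S.Compatible A B

/-- If the pure state `T_(1; F) ω` predicts the outcome of `A` with certainty, then `F` and `A` are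
compatible; and only pure states predict outcomes of nondegenerate observables with certainty. -/
def Eigenstates : Prop :=
  (∀ ω, S.IsCompletelyMixed ω → ∀ F, S.IsProjectionOfRank 1 F → ∀ A, ∀ α ∈ S.spectrum A,
      (S.prob (S.update {1} F ω) A).real {α} = 1 → S.Compatible F A) ∧
    ∀ A, S.IsNondegenerate A → ∀ α ∈ S.spectrum A, ∀ ρ, ρ ≠ S.null →
      (S.prob ρ A).real {α} = 1 → S.IsPure ρ

/-- Symmetry of transition probabilities between rank-one projections:
`P(E → F) = P(F → E)`, where `P(E → F)` is the probability of `(1; F)` in the state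
`T_(1; E) ω`. -/
def TransitionSymmetry : Prop :=
  ∀ ω, S.IsCompletelyMixed ω → ∀ E F, S.IsProjectionOfRank 1 E → S.IsProjectionOfRank 1 F →
    (S.prob (S.update {1} E ω) F).real {1} = (S.prob (S.update {1} F ω) E).real {1}

end

end PhysicalSystem

/-!
In the Heisenberg picture the outcome `a` of the observable `A` acts linearly on functions of the
state, by `φ ↦ P_ρ(a; A) φ(T_(a; A) ρ)`, and sequential probabilities are obtained by applying
compositions of these operators to the function `1` on the non-null states. The compatibility
postulate says that the operators of compatible observables commute, and that the product of the
outcomes `f(C) = a`, `g(C) = b` is the outcome `1` of the indicator observable of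
`{f = a, g = b}`. The commutativity postulate is a converse, and gives Specker's principle: if `A`,
`B`, `Z` are pairwise compatible, `Z` is compatible with joint functions of `A` and `B`, because
`1` is the sum over all outcomes of what `A = a`, `B = b` makes of `1`, and on each summand both
orders of measurement agree. Hence pairwise compatible outcomes have a conjunction, the outcome `1`
of one projection. When two conjunctions contain different outcomes of a common observable, finding
the one false does not disturb the other. Testing the conjunctions one after another, as long as
they fail, then exhibits their probabilities as those of exclusive events.
-/

namespace PhysicalSystem

section

variable {Obs State : Type*} {S : PhysicalSystem Obs State}

/-! ### Distributions of observables -/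

instance isFiniteMeasure_prob (ρ : State) (A : Obs) : IsFiniteMeasure (S.prob ρ A) := by
  by_cases hρ : ρ = S.null
  · rw [hρ, S.prob_null]
    infer_instance
  · have := S.isProbabilityMeasure_prob ρ A hρ
    infer_instance

@[simp] lemma real_prob_null (A : Obs) (Δ : Set ℝ) : (S.prob S.null A).real Δ = 0 := by
  simp [S.prob_null]

lemma exists_real_prob_ne_zero {A : Obs} {a : ℝ} (ha : a ∈ S.spectrum A) :
    ∃ ρ, (S.prob ρ A).real {a} ≠ 0 := by
  by_contra! hzero
  refine Set.mem_sInter.mp ha {a}ᶜ ⟨(measurableSet_singleton a).compl, fun ρ hρ => ?_⟩ rfl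
  have := S.isProbabilityMeasure_prob ρ A hρ
  rw [prob_compl_eq_one_iff (measurableSet_singleton a)]
  exact (measureReal_eq_zero_iff).mp (hzero ρ)

namespace IsFiniteDimensional

lemma ae_mem_spectrum (hfin : S.IsFiniteDimensional) (ρ : State) (A : Obs) :
    ∀ᵐ x ∂S.prob ρ A, x ∈ S.spectrum A := by
  by_cases hρ : ρ = S.null
  · simp [hρ, S.prob_null]
  · have := S.isProbabilityMeasure_prob ρ A hρ
    exact (mem_ae_iff_prob_eq_one (hfin.finite_spectrum A).measurableSet).mpr
      (hfin.prob_spectrum A ρ hρ)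

lemma real_prob_congr (hfin : S.IsFiniteDimensional) {A : Obs} {Δ Γ : Set ℝ}
    (h : ∀ x ∈ S.spectrum A, x ∈ Δ ↔ x ∈ Γ) (ρ : State) :
    (S.prob ρ A).real Δ = (S.prob ρ A).real Γ :=
  measureReal_congr <| (hfin.ae_mem_spectrum ρ A).mono fun x hx => propext (h x hx)

lemma real_prob_singleton_eq_zero (hfin : S.IsFiniteDimensional) {A : Obs} {a : ℝ}
    (ha : a ∉ S.spectrum A) (ρ : State) : (S.prob ρ A).real {a} = 0 := by
  rw [hfin.real_prob_congr (Γ := ∅), measureReal_empty]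
  intro x hx
  simpa using fun hxa : x = a => ha (hxa ▸ hx)

lemma nonempty_spectrum (hfin : S.IsFiniteDimensional) (A : Obs) : (S.spectrum A).Nonempty := by
  obtain ⟨ρ, hρ⟩ := S.exists_ne_null
  by_contra hempty
  simpa [Set.not_nonempty_iff_eq_empty.mp hempty] using hfin.prob_spectrum A ρ hρ

lemma isFunctionVia_iff (hfin : S.IsFiniteDimensional) {f : ℝ → ℝ} {A B : Obs} :
    S.IsFunctionVia f A B ↔ Set.MapsTo f (S.spectrum A) (S.spectrum B) ∧
      ∀ ρ Γ, (S.prob ρ B).real Γ = (S.prob ρ A).real (f ⁻¹' Γ) := by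
  refine and_congr_right fun hmaps => ⟨fun h ρ Γ => ?_, fun h ρ _ Γ _ => ?_⟩
  · by_cases hρ : ρ = S.null
    · simp [hρ]
    rw [hfin.real_prob_congr (Γ := S.spectrum B ∩ Γ) (by simp +contextual),
      h ρ hρ _ Set.inter_subset_left]
    refine hfin.real_prob_congr (fun x hx => ?_) ρ
    simp [hx, hmaps hx]
  · rw [h]
    exact hfin.real_prob_congr (by simp +contextual) ρ

end IsFiniteDimensional

/-! ### Functions of observables -/

namespace IsFunctionVia

variable {A B D : Obs} {f g : ℝ → ℝ}

lemma refl (A : Obs) : S.IsFunctionVia id A A :=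
  ⟨Set.mapsTo_id _, fun _ _ Γ hΓ => by rw [Set.preimage_id, Set.inter_eq_right.mpr hΓ]⟩

lemma real_prob (hf : S.IsFunctionVia f A B) (hfin : S.IsFiniteDimensional) (ρ : State)
    (Γ : Set ℝ) : (S.prob ρ B).real Γ = (S.prob ρ A).real (f ⁻¹' Γ) :=
  (hfin.isFunctionVia_iff.mp hf).2 ρ Γ

lemma surjOn (hf : S.IsFunctionVia f A B) (hfin : S.IsFiniteDimensional) :
    Set.SurjOn f (S.spectrum A) (S.spectrum B) := by
  intro b hb
  obtain ⟨ρ, hρ⟩ := exists_real_prob_ne_zero hb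
  by_contra hne
  refine hρ ?_
  rw [hf.real_prob hfin, hfin.real_prob_congr (Γ := ∅), measureReal_empty]
  exact fun x hx => iff_of_false (fun hxb => hne ⟨x, hx, hxb⟩) id

lemma comp (hg : S.IsFunctionVia g B D) (hf : S.IsFunctionVia f A B)
    (hfin : S.IsFiniteDimensional) : S.IsFunctionVia (g ∘ f) A D :=
  hfin.isFunctionVia_iff.mpr ⟨hg.1.comp hf.1, fun ρ Γ => by
    rw [hg.real_prob hfin, hf.real_prob hfin, Set.preimage_comp]⟩

lemma of_comp (hgf : S.IsFunctionVia (g ∘ f) A D) (hf : S.IsFunctionVia f A B)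
    (hfin : S.IsFiniteDimensional) : S.IsFunctionVia g B D := by
  refine hfin.isFunctionVia_iff.mpr ⟨fun b hb => ?_, fun ρ Γ => ?_⟩
  · obtain ⟨x, hx, rfl⟩ := hf.surjOn hfin hb
    exact hgf.1 hx
  · rw [hgf.real_prob hfin, hf.real_prob hfin, Set.preimage_comp]

lemma congr (hf : S.IsFunctionVia f A B) (hfg : Set.EqOn f g (S.spectrum A))
    (hfin : S.IsFiniteDimensional) : S.IsFunctionVia g A B :=
  hfin.isFunctionVia_iff.mpr ⟨hf.1.congr hfg, fun ρ Γ => by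
    rw [hf.real_prob hfin]
    exact hfin.real_prob_congr (fun x hx => by simp only [Set.mem_preimage, hfg hx]) ρ⟩

lemma const_of_const {r : ℝ} (hA : S.IsFunctionVia (fun _ => r) A D)
    (hfin : S.IsFiniteDimensional) (B : Obs) : S.IsFunctionVia (fun _ => r) B D := by
  refine hfin.isFunctionVia_iff.mpr ⟨fun _ _ => ?_, fun ρ Γ => ?_⟩
  · obtain ⟨x, hx⟩ := hfin.nonempty_spectrum A
    exact hA.1 hx
  · by_cases hρ : ρ = S.null
    · simp [hρ]
    have := S.isProbabilityMeasure_prob ρ A hρ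
    have := S.isProbabilityMeasure_prob ρ B hρ
    rw [hA.real_prob hfin]
    by_cases hr : r ∈ Γ <;> simp [hr]

end IsFunctionVia

lemma Compatible.refl (A : Obs) : S.Compatible A A :=
  ⟨A, id, id, .refl A, .refl A⟩

lemma Compatible.symm {A B : Obs} : S.Compatible A B → S.Compatible B A
  | ⟨C, f, g, hf, hg⟩ => ⟨C, g, f, hg, hf⟩

variable (S) in
/-- Closure under functional calculus: every real function of every observable, degenerate or not,
is an observable. -/
def HasFunctionalCalculus : Prop :=
  ∀ (A : Obs) (f : ℝ → ℝ), ∃ B, S.IsFunctionVia f A B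

lemma ObservablesAndStates.hasFunctionalCalculus (hobs : S.ObservablesAndStates)
    (hfin : S.IsFiniteDimensional) : S.HasFunctionalCalculus := by
  intro A f
  by_cases hA : S.IsNondegenerate A
  · exact hobs.2.1 A hA f
  · obtain ⟨C, g, hC, hg, -⟩ := hobs.1 A hA
    obtain ⟨B, hB⟩ := hobs.2.1 C hC (f ∘ g)
    exact ⟨B, hB.of_comp hg hfin⟩

lemma HasFunctionalCalculus.exists_isChar (hfun : S.HasFunctionalCalculus) {A : Obs} {Δ : Set ℝ}
    (hΔ : Δ ⊆ S.spectrum A) : ∃ E, S.IsChar Δ A E :=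
  (hfun A _).imp fun _ hE => ⟨hΔ, hE⟩

namespace IsChar

variable {A C E : Obs} {Δ : Set ℝ} {f : ℝ → ℝ}

lemma spectrum_subset (hE : S.IsChar Δ A E) (hfin : S.IsFiniteDimensional) :
    S.spectrum E ⊆ {0, 1} := by
  intro x hx
  obtain ⟨c, -, rfl⟩ := hE.2.surjOn hfin hx
  by_cases hc : c ∈ Δ <;> simp [hc]

lemma real_prob_one (hE : S.IsChar Δ A E) (hfin : S.IsFiniteDimensional) (ρ : State) :
    (S.prob ρ E).real {1} = (S.prob ρ A).real Δ := by
  rw [hE.2.real_prob hfin]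
  congr 1
  ext x
  by_cases hx : x ∈ Δ <;> simp [hx]

lemma preimage (hE : S.IsChar Δ A E) (hf : S.IsFunctionVia f C A)
    (hfin : S.IsFiniteDimensional) : S.IsChar (S.spectrum C ∩ f ⁻¹' Δ) C E := by
  refine ⟨Set.inter_subset_left, (hE.2.comp hf hfin).congr (fun x hx => ?_) hfin⟩
  by_cases hfx : f x ∈ Δ <;> simp [hx, hfx]

end IsChar

/-! ### Outcome operators -/

variable (S) in
/-- The operation of observing the outcome `a` of `A`, in the Heisenberg picture: it takes a
function `φ` of the state to its value after the update, weighted with the probability of the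
outcome. The outcome observed first is the left factor of a product of such operators. -/
noncomputable def outcomeOp (A : Obs) (a : ℝ) : Module.End ℝ (State → ℝ) where
  toFun φ ρ := (S.prob ρ A).real {a} * φ (S.update {a} A ρ)
  map_add' φ ψ := by ext; simp [mul_add]
  map_smul' r φ := by ext; simp [mul_left_comm]

variable (S) in
/-- The effect that occurs with certainty. It vanishes at the null state, so that it is the sum of
the effects of the outcomes of an observable at that state, too. -/
noncomputable def unitEffect : State → ℝ :=
  Set.indicator {S.null}ᶜ 1

lemma unitEffect_of_ne_null {ρ : State} (hρ : ρ ≠ S.null) : S.unitEffect ρ = 1 :=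
  Set.indicator_of_mem hρ 1

@[simp] lemma unitEffect_null : S.unitEffect S.null = 0 :=
  Set.indicator_of_notMem (by simp) 1

lemma outcomeOp_apply (A : Obs) (a : ℝ) (φ : State → ℝ) (ρ : State) :
    S.outcomeOp A a φ ρ = (S.prob ρ A).real {a} * φ (S.update {a} A ρ) := rfl

lemma outcomeOp_mul_apply (A B : Obs) (a b : ℝ) (φ : State → ℝ) (ρ : State) :
    (S.outcomeOp A a * S.outcomeOp B b) φ ρ =
      (S.prob ρ A).real {a} * (S.prob (S.update {a} A ρ) B).real {b} *
        φ (S.update {b} B (S.update {a} A ρ)) :=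
  (mul_assoc ..).symm

lemma outcomeOp_mono (A : Obs) (a : ℝ) : Monotone (S.outcomeOp A a) :=
  fun _ _ hφψ _ => mul_le_mul_of_nonneg_left (hφψ _) measureReal_nonneg

lemma outcomeOp_mul_self (hfin : S.IsFiniteDimensional) (hself : S.SelfCompatibility)
    (A : Obs) (a : ℝ) : S.outcomeOp A a * S.outcomeOp A a = S.outcomeOp A a := by
  ext φ ρ
  rw [outcomeOp_mul_apply, outcomeOp_apply]
  by_cases hP : (S.prob ρ A).real {a} = 0
  · simp [hP]
  have hρ : ρ ≠ S.null := by
    rintro rfl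
    exact hP (real_prob_null A _)
  have ha : a ∈ S.spectrum A := not_imp_comm.mp (hfin.real_prob_singleton_eq_zero · ρ) hP
  obtain ⟨hcond, hidem, -⟩ := hself A a ha
  rw [hidem, hcond ρ hρ {a} (Set.singleton_subset_iff.mpr ha), Set.inter_self,
    mul_div_cancel₀ _ hP]

lemma update_ne_null (hfin : S.IsFiniteDimensional) (hself : S.SelfCompatibility) {A : Obs}
    {a : ℝ} {ρ : State} (hP : (S.prob ρ A).real {a} ≠ 0) : S.update {a} A ρ ≠ S.null := by
  intro hnull
  have hidem := congr($(outcomeOp_mul_self hfin hself A a) 1 ρ)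
  rw [outcomeOp_mul_apply, outcomeOp_apply, hnull] at hidem
  exact hP (by simpa using hidem.symm)

lemma outcomeOp_unitEffect (hfin : S.IsFiniteDimensional) (hself : S.SelfCompatibility)
    (A : Obs) (a : ℝ) (ρ : State) :
    S.outcomeOp A a S.unitEffect ρ = (S.prob ρ A).real {a} := by
  rw [outcomeOp_apply]
  by_cases hP : (S.prob ρ A).real {a} = 0
  · simp [hP]
  · rw [unitEffect_of_ne_null (update_ne_null hfin hself hP), mul_one]

lemma sum_outcomeOp_unitEffect (hfin : S.IsFiniteDimensional) (hself : S.SelfCompatibility)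
    (A : Obs) :
    ∑ a ∈ (hfin.finite_spectrum A).toFinset, S.outcomeOp A a S.unitEffect = S.unitEffect := by
  ext ρ
  simp only [Finset.sum_apply, outcomeOp_unitEffect hfin hself, sum_measureReal_singleton,
    Set.Finite.coe_toFinset]
  by_cases hρ : ρ = S.null
  · simp [hρ]
  · rw [unitEffect_of_ne_null hρ, measureReal_def, hfin.prob_spectrum A ρ hρ, ENNReal.toReal_one]

lemma outcomeOp_unitEffect_add_le (hfin : S.IsFiniteDimensional) (hself : S.SelfCompatibility)
    (A : Obs) {a b : ℝ} (hab : a ≠ b) :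
    S.outcomeOp A a S.unitEffect + S.outcomeOp A b S.unitEffect ≤ S.unitEffect := by
  intro ρ
  simp only [Pi.add_apply, outcomeOp_unitEffect hfin hself]
  by_cases hρ : ρ = S.null
  · simp [hρ]
  · have := S.isProbabilityMeasure_prob ρ A hρ
    rw [unitEffect_of_ne_null hρ,
      ← measureReal_union (Set.disjoint_singleton.mpr hab) (measurableSet_singleton b)]
    exact measureReal_le_one

/-! ### Products of outcomes of compatible observables -/

section Product

variable {A B C D : Obs} {f g k : ℝ → ℝ} {a b d : ℝ}

lemma real_prob_mul_update (hfin : S.IsFiniteDimensional) (hcompat : S.Compatibility)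
    (hf : S.IsFunctionVia f C A) (hg : S.IsFunctionVia g C B) (a b : ℝ) (ρ : State) :
    (S.prob ρ A).real {a} * (S.prob (S.update {a} A ρ) B).real {b} =
      (S.prob ρ C).real (f ⁻¹' {a} ∩ g ⁻¹' {b}) := by
  by_cases ha : a ∈ S.spectrum A
  swap
  · rw [hfin.real_prob_singleton_eq_zero ha, zero_mul, measureReal_mono_null Set.inter_subset_left]
    rw [← hf.real_prob hfin, hfin.real_prob_singleton_eq_zero ha]
  by_cases hb : b ∈ S.spectrum B
  swap
  · rw [hfin.real_prob_singleton_eq_zero hb, mul_zero, measureReal_mono_null Set.inter_subset_right]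
    rw [← hg.real_prob hfin, hfin.real_prob_singleton_eq_zero hb]
  by_cases hρ : ρ = S.null
  · simp [hρ]
  have hjoint := hcompat.1 A B C f g hf hg ρ hρ {a} (Set.singleton_subset_iff.mpr ha) {b}
    (Set.singleton_subset_iff.mpr hb)
  simp only [seqProb, mul_one] at hjoint
  rw [hjoint]
  exact hfin.real_prob_congr (by simp +contextual) ρ

lemma outcomeOp_mul_of_isChar (hfin : S.IsFiniteDimensional) (hfun : S.HasFunctionalCalculus)
    (hcompat : S.Compatibility) (hf : S.IsFunctionVia f C A) (hg : S.IsFunctionVia g C B)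
    (hD : S.IsChar (S.spectrum C ∩ (f ⁻¹' {a} ∩ g ⁻¹' {b})) C D) :
    S.outcomeOp A a * S.outcomeOp B b = S.outcomeOp D 1 := by
  ext φ ρ
  have hprob : (S.prob ρ A).real {a} * (S.prob (S.update {a} A ρ) B).real {b} =
      (S.prob ρ D).real {1} := by
    rw [real_prob_mul_update hfin hcompat hf hg, hD.real_prob_one hfin]
    exact hfin.real_prob_congr (by simp +contextual) ρ
  rw [outcomeOp_mul_apply, outcomeOp_apply, hprob]
  by_cases hP : (S.prob ρ D).real {1} = 0
  · simp [hP]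
  have ha : a ∈ S.spectrum A := by
    by_contra ha
    exact hP (by rw [← hprob, hfin.real_prob_singleton_eq_zero ha, zero_mul])
  have hb : b ∈ S.spectrum B := by
    by_contra hb
    exact hP (by rw [← hprob, hfin.real_prob_singleton_eq_zero hb, mul_zero])
  obtain ⟨E, hE⟩ := hfun.exists_isChar (Set.singleton_subset_iff.mpr ha)
  obtain ⟨F, hF⟩ := hfun.exists_isChar (Set.singleton_subset_iff.mpr hb)
  have hFED : S.IsProduct F E D := by
    refine ⟨C, _, _, hF.preimage hg hfin, hE.preimage hf hfin, ?_⟩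
    rwa [← Set.inter_inter_distrib_left, Set.inter_comm (g ⁻¹' {b})]
  rw [hcompat.2 B A ⟨C, g, f, hg, hf⟩ b hb a ha F E D hF hE hFED]

lemma outcomeOp_mul_eq (hfin : S.IsFiniteDimensional) (hself : S.SelfCompatibility)
    (hfun : S.HasFunctionalCalculus) (hcompat : S.Compatibility) (hf : S.IsFunctionVia f C A)
    (hg : S.IsFunctionVia g C B) (hk : S.IsFunctionVia k C D)
    (hfgk : ∀ c ∈ S.spectrum C, k c = d ↔ f c = a ∧ g c = b) :
    S.outcomeOp A a * S.outcomeOp B b = S.outcomeOp D d := by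
  obtain ⟨E, hE⟩ := hfun.exists_isChar
    (Set.inter_subset_left : S.spectrum C ∩ (f ⁻¹' {a} ∩ g ⁻¹' {b}) ⊆ S.spectrum C)
  have hset : S.spectrum C ∩ (f ⁻¹' {a} ∩ g ⁻¹' {b}) =
      S.spectrum C ∩ (k ⁻¹' {d} ∩ k ⁻¹' {d}) := by
    ext c
    simpa using fun hc => (hfgk c hc).symm
  rw [outcomeOp_mul_of_isChar hfin hfun hcompat hf hg hE, ← outcomeOp_mul_self hfin hself D d,
    outcomeOp_mul_of_isChar hfin hfun hcompat hk hk (hset ▸ hE)]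

lemma outcomeOp_mul_eq_zero_iff (hfin : S.IsFiniteDimensional) (hcompat : S.Compatibility)
    (hf : S.IsFunctionVia f C A) (hg : S.IsFunctionVia g C B) :
    S.outcomeOp A a * S.outcomeOp B b = 0 ↔ ∀ c ∈ S.spectrum C, f c = a → g c ≠ b := by
  constructor
  · rintro hzero c hc rfl rfl
    obtain ⟨ρ, hρ⟩ := exists_real_prob_ne_zero hc
    have hnull := congr($hzero 1 ρ)
    rw [outcomeOp_mul_apply, real_prob_mul_update hfin hcompat hf hg] at hnull
    refine hρ (measureReal_mono_null (s₂ := f ⁻¹' {f c} ∩ g ⁻¹' {g c}) (by simp) ?_)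
    simpa using hnull
  · intro hdisj
    ext φ ρ
    rw [outcomeOp_mul_apply, real_prob_mul_update hfin hcompat hf hg,
      hfin.real_prob_congr (Γ := ∅) (by simpa using hdisj)]
    simp

lemma outcomeOp_commute (hfin : S.IsFiniteDimensional) (hfun : S.HasFunctionalCalculus)
    (hcompat : S.Compatibility) (hAB : S.Compatible A B) (a b : ℝ) :
    Commute (S.outcomeOp A a) (S.outcomeOp B b) := by
  obtain ⟨C, f, g, hf, hg⟩ := hAB
  obtain ⟨E, hE⟩ := hfun.exists_isChar
    (Set.inter_subset_left : S.spectrum C ∩ (f ⁻¹' {a} ∩ g ⁻¹' {b}) ⊆ S.spectrum C)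
  rw [commute_iff_eq, outcomeOp_mul_of_isChar hfin hfun hcompat hf hg hE,
    outcomeOp_mul_of_isChar hfin hfun hcompat hg hf (Set.inter_comm (f ⁻¹' {a}) _ ▸ hE)]

lemma outcomeOp_mul_of_ne (hfin : S.IsFiniteDimensional) (hcompat : S.Compatibility) (A : Obs)
    (hab : a ≠ b) : S.outcomeOp A a * S.outcomeOp A b = 0 :=
  (outcomeOp_mul_eq_zero_iff hfin hcompat (.refl A) (.refl A)).mpr fun _ _ ha hb =>
    hab (ha.symm.trans hb)

lemma outcomeOp_mul_eq_right_of_forall_ne (hfin : S.IsFiniteDimensional)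
    (hself : S.SelfCompatibility) (hfun : S.HasFunctionalCalculus) (hcompat : S.Compatibility)
    (hAB : S.Compatible A B)
    (hzero : ∀ a' ∈ S.spectrum A, a' ≠ a → S.outcomeOp A a' * S.outcomeOp B b = 0) :
    S.outcomeOp A a * S.outcomeOp B b = S.outcomeOp B b := by
  obtain ⟨C, f, g, hf, hg⟩ := hAB
  refine outcomeOp_mul_eq hfin hself hfun hcompat hf hg hg fun c hc => ?_
  refine ⟨fun hgc => ⟨?_, hgc⟩, And.right⟩
  by_contra hfc
  exact (outcomeOp_mul_eq_zero_iff hfin hcompat hf hg).mp (hzero _ (hf.1 hc) hfc) c hc rfl hgc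

/-! ### Specker's principle -/

lemma real_prob_mul_update_finset (hfin : S.IsFiniteDimensional) (hsubj : S.SubjectiveUpdate)
    (hself : S.SelfCompatibility) {ρ : State} (hρ : ρ ≠ S.null) {Δ Γ : Finset ℝ}
    (hΔ : (Δ : Set ℝ) ⊆ S.spectrum A) (hΓ : (Γ : Set ℝ) ⊆ S.spectrum B) :
    (S.prob ρ A).real Δ * (S.prob (S.update Δ A ρ) B).real Γ =
      ∑ a ∈ Δ, ∑ b ∈ Γ, S.outcomeOp A a (S.outcomeOp B b S.unitEffect) ρ := by
  have hmixture := hsubj.2 A Δ hΔ ρ hρ [((Γ : Set ℝ), B)] (List.cons_ne_nil _ _) (by simpa)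
  simp only [seqProb, mul_one] at hmixture
  rw [hmixture, Finset.mul_sum]
  refine Finset.sum_congr rfl fun a ha => ?_
  simp only [outcomeOp_apply A, outcomeOp_unitEffect hfin hself]
  rw [← Finset.mul_sum, sum_measureReal_singleton, ← mul_assoc]
  congr 1
  refine mul_div_cancel_of_imp' fun hΔ0 => ?_
  exact measureReal_mono_null (Set.singleton_subset_iff.mpr ha) hΔ0

lemma compatible_of_outcomeOp_comm (hfin : S.IsFiniteDimensional) (hsubj : S.SubjectiveUpdate)
    (hself : S.SelfCompatibility) (hcomm : S.Commutativity)
    (hAB : ∀ a b, S.outcomeOp A a (S.outcomeOp B b S.unitEffect) =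
      S.outcomeOp B b (S.outcomeOp A a S.unitEffect)) : S.Compatible A B := by
  refine hcomm A B fun ρ hρ Δ hΔ Γ hΓ => ?_
  lift Δ to Finset ℝ using (hfin.finite_spectrum A).subset hΔ
  lift Γ to Finset ℝ using (hfin.finite_spectrum B).subset hΓ
  rw [real_prob_mul_update_finset hfin hsubj hself hρ hΔ hΓ,
    real_prob_mul_update_finset hfin hsubj hself hρ hΓ hΔ, Finset.sum_comm]
  simp only [hAB]

lemma outcomeOp_mul_mul_eq_or_eq_zero (hfin : S.IsFiniteDimensional)
    (hself : S.SelfCompatibility) (hfun : S.HasFunctionalCalculus) (hcompat : S.Compatibility)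
    (hf : S.IsFunctionVia f C A) (hg : S.IsFunctionVia g C B) (hk : S.IsFunctionVia k C D)
    (hfgk : ∀ c ∈ S.spectrum C, ∀ c' ∈ S.spectrum C, f c = f c' → g c = g c' → k c = k c')
    (a b d : ℝ) :
    S.outcomeOp D d * (S.outcomeOp A a * S.outcomeOp B b) = S.outcomeOp A a * S.outcomeOp B b ∨
      S.outcomeOp D d * (S.outcomeOp A a * S.outcomeOp B b) = 0 := by
  obtain ⟨E, hE⟩ := hfun.exists_isChar
    (Set.inter_subset_left : S.spectrum C ∩ (f ⁻¹' {a} ∩ g ⁻¹' {b}) ⊆ S.spectrum C)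
  rw [outcomeOp_mul_of_isChar hfin hfun hcompat hf hg hE]
  have hmem (c : ℝ) (hc : (S.spectrum C ∩ (f ⁻¹' {a} ∩ g ⁻¹' {b})).indicator (fun _ => 1) c =
      (1 : ℝ)) : c ∈ S.spectrum C ∩ (f ⁻¹' {a} ∩ g ⁻¹' {b}) :=
    Set.mem_of_indicator_ne_zero (hc.trans_ne one_ne_zero)
  by_cases hd : ∃ c ∈ S.spectrum C, f c = a ∧ g c = b ∧ k c = d
  · obtain ⟨c, hc, rfl, rfl, rfl⟩ := hd
    refine .inl (outcomeOp_mul_eq hfin hself hfun hcompat hk hE.2 hE.2 fun c' hc' => ?_)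
    refine ⟨fun h => ⟨?_, h⟩, And.right⟩
    exact hfgk c' hc' c hc (hmem c' h).2.1 (hmem c' h).2.2
  · refine .inr ((outcomeOp_mul_eq_zero_iff hfin hcompat hk hE.2).mpr fun c hc hkc h => ?_)
    exact hd ⟨c, hc, (hmem c h).2.1, (hmem c h).2.2, hkc⟩

theorem Compatible.of_joint_function {Z : Obs} (hfin : S.IsFiniteDimensional)
    (hsubj : S.SubjectiveUpdate) (hself : S.SelfCompatibility) (hfun : S.HasFunctionalCalculus)
    (hcompat : S.Compatibility) (hcomm : S.Commutativity) (hf : S.IsFunctionVia f C A)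
    (hg : S.IsFunctionVia g C B) (hk : S.IsFunctionVia k C D)
    (hfgk : ∀ c ∈ S.spectrum C, ∀ c' ∈ S.spectrum C, f c = f c' → g c = g c' → k c = k c')
    (hAZ : S.Compatible A Z) (hBZ : S.Compatible B Z) : S.Compatible D Z := by
  refine compatible_of_outcomeOp_comm hfin hsubj hself hcomm fun d z => ?_
  have hagree (a b : ℝ) :
      S.outcomeOp D d * S.outcomeOp Z z * (S.outcomeOp A a * S.outcomeOp B b) =
        S.outcomeOp Z z * S.outcomeOp D d * (S.outcomeOp A a * S.outcomeOp B b) := by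
    have hZ : Commute (S.outcomeOp Z z) (S.outcomeOp A a * S.outcomeOp B b) :=
      (outcomeOp_commute hfin hfun hcompat hAZ.symm z a).mul_right
        (outcomeOp_commute hfin hfun hcompat hBZ.symm z b)
    rw [mul_assoc, hZ.eq, ← mul_assoc, mul_assoc (S.outcomeOp Z z)]
    obtain h | h := outcomeOp_mul_mul_eq_or_eq_zero hfin hself hfun hcompat hf hg hk hfgk a b d
    · rw [h, hZ.eq]
    · rw [h, zero_mul, mul_zero]
  have hunit : ∑ a ∈ (hfin.finite_spectrum A).toFinset, ∑ b ∈ (hfin.finite_spectrum B).toFinset,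
      S.outcomeOp A a (S.outcomeOp B b S.unitEffect) = S.unitEffect := by
    simp only [← map_sum, sum_outcomeOp_unitEffect hfin hself]
  rw [← hunit]
  simp only [map_sum]
  exact Finset.sum_congr rfl fun a _ => Finset.sum_congr rfl fun b _ =>
    congr($(hagree a b) S.unitEffect)

end Product

/-! ### Conjunctions of compatible outcomes -/

variable (S) in
/-- `G` is the projection `χ_{α₁}(A₁) ∘ ⋯ ∘ χ_{αₘ}(Aₘ)`: its outcome `1` has the probability of the
sequence of outcomes and entails each of them, and `G` is compatible with whatever all `Aᵢ` are
compatible with. The definition records these properties instead of a construction, as no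
observable needs to be at hand of which all `Aᵢ` are functions. -/
structure IsConjunction {m : ℕ} (α : Fin m → ℝ) (A : Fin m → Obs) (G : Obs) : Prop where
  spectrum_subset : S.spectrum G ⊆ {0, 1}
  real_prob_one : ∀ ρ, ρ ≠ S.null → (S.prob ρ G).real {1} = S.jointProb ρ α A
  outcomeOp_mul : ∀ i, S.outcomeOp (A i) (α i) * S.outcomeOp G 1 = S.outcomeOp G 1
  compatible : ∀ Z, (∀ i, S.Compatible (A i) Z) → S.Compatible G Z

lemma jointProb_succ {m : ℕ} (ρ : State) (α : Fin (m + 1) → ℝ) (A : Fin (m + 1) → Obs) :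
    S.jointProb ρ α A = (S.prob ρ (A 0)).real {α 0} *
      S.jointProb (S.update {α 0} (A 0) ρ) (Fin.tail α) (Fin.tail A) := by
  simp only [jointProb, List.ofFn_succ, seqProb, Fin.tail]

namespace IsConjunction

lemma exists_of_isEmpty (hfin : S.IsFiniteDimensional) (hfun : S.HasFunctionalCalculus)
    (α : Fin 0 → ℝ) (A : Fin 0 → Obs) : ∃ G, S.IsConjunction α A G := by
  obtain ⟨C⟩ := S.nonempty_obs
  obtain ⟨G, hG⟩ := hfun C fun _ => 1
  refine ⟨G, fun x hx => ?_, fun ρ hρ => ?_, fun i => i.elim0, fun Z _ => ?_⟩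
  · obtain ⟨-, -, rfl⟩ := hG.surjOn hfin hx
    simp
  · have := S.isProbabilityMeasure_prob ρ C hρ
    simp [hG.real_prob hfin, jointProb, seqProb]
  · exact ⟨Z, _, id, hG.const_of_const hfin Z, .refl Z⟩

lemma exists_of_tail {m : ℕ} {α : Fin (m + 1) → ℝ} {A : Fin (m + 1) → Obs} {F : Obs}
    (hfin : S.IsFiniteDimensional) (hsubj : S.SubjectiveUpdate) (hself : S.SelfCompatibility)
    (hfun : S.HasFunctionalCalculus) (hcompat : S.Compatibility) (hcomm : S.Commutativity)
    (hA : ∀ i, S.Compatible (A i) (A 0)) (hF : S.IsConjunction (Fin.tail α) (Fin.tail A) F) :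
    ∃ G, S.IsConjunction α A G := by
  obtain ⟨C, f, g, hf, hg⟩ : S.Compatible (A 0) F := (hF.compatible (A 0) fun i => hA i.succ).symm
  obtain ⟨G, hG⟩ := hfun.exists_isChar
    (Set.inter_subset_left : S.spectrum C ∩ (f ⁻¹' {α 0} ∩ g ⁻¹' {1}) ⊆ S.spectrum C)
  have hmul : S.outcomeOp (A 0) (α 0) * S.outcomeOp F 1 = S.outcomeOp G 1 :=
    outcomeOp_mul_of_isChar hfin hfun hcompat hf hg hG
  refine ⟨G, hG.spectrum_subset hfin, fun ρ _ => ?_, fun i => ?_, fun Z hZ => ?_⟩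
  · rw [← outcomeOp_unitEffect hfin hself, ← hmul, Module.End.mul_apply, outcomeOp_apply,
      outcomeOp_unitEffect hfin hself, jointProb_succ]
    by_cases hP : (S.prob ρ (A 0)).real {α 0} = 0
    · simp [hP]
    · rw [hF.real_prob_one _ (update_ne_null hfin hself hP)]
  · cases i using Fin.cases with
    | zero => rw [← hmul, ← mul_assoc, outcomeOp_mul_self hfin hself]
    | succ i =>
      rw [← hmul, (outcomeOp_commute hfin hfun hcompat (hA i.succ) _ _).left_comm]
      exact congrArg _ (hF.outcomeOp_mul i)
  · refine .of_joint_function hfin hsubj hself hfun hcompat hcomm hf hg hG.2 ?_ (hZ 0)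
      (hF.compatible Z fun i => hZ i.succ)
    intro c hc c' hc' hfc hgc
    simp only [Set.indicator, Set.mem_inter_iff, Set.mem_preimage, hc, hc', hfc, hgc]

/-- If `G'` has the outcome `1` then `A i` has the outcome `α' i`, which excludes `α i` and with it
the outcome `1` of `G`. -/
lemma outcomeOp_zero_mul_one {m : ℕ} {α α' : Fin m → ℝ} {A A' : Fin m → Obs} {G G' : Obs}
    (hfin : S.IsFiniteDimensional) (hself : S.SelfCompatibility)
    (hfun : S.HasFunctionalCalculus) (hcompat : S.Compatibility)
    (hG : S.IsConjunction α A G) (hG' : S.IsConjunction α' A' G') {i : Fin m}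
    (hA : ∀ i', S.Compatible (A i') (A i)) (hAA' : A i = A' i) (hαα' : α i ≠ α' i) :
    S.outcomeOp G 0 * S.outcomeOp G' 1 = S.outcomeOp G' 1 := by
  have hGA : S.Compatible G (A i) := hG.compatible (A i) hA
  have hexclusive : S.outcomeOp G 1 * S.outcomeOp (A i) (α' i) = 0 := by
    rw [← hG.outcomeOp_mul i, (outcomeOp_commute hfin hfun hcompat hGA 1 (α i)).symm.eq, mul_assoc,
      outcomeOp_mul_of_ne hfin hcompat (A i) hαα', mul_zero]
  have hfails : S.outcomeOp G 0 * S.outcomeOp (A i) (α' i) = S.outcomeOp (A i) (α' i) :=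
    outcomeOp_mul_eq_right_of_forall_ne hfin hself hfun hcompat hGA fun x hx hx0 =>
      (hG.spectrum_subset hx).resolve_left hx0 ▸ hexclusive
  rw [← hG'.outcomeOp_mul i, ← hAA', ← mul_assoc, hfails]

end IsConjunction

theorem exists_isConjunction {m : ℕ} (α : Fin m → ℝ) {A : Fin m → Obs}
    (hfin : S.IsFiniteDimensional) (hsubj : S.SubjectiveUpdate) (hself : S.SelfCompatibility)
    (hfun : S.HasFunctionalCalculus) (hcompat : S.Compatibility) (hcomm : S.Commutativity)
    (hA : ∀ i i', S.Compatible (A i) (A i')) : ∃ G, S.IsConjunction α A G := by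
  induction m with
  | zero => exact IsConjunction.exists_of_isEmpty hfin hfun α A
  | succ m ih =>
    obtain ⟨F, hF⟩ := ih (Fin.tail α) fun i i' => hA i.succ i'.succ
    exact hF.exists_of_tail hfin hsubj hself hfun hcompat hcomm fun i => hA i 0

/-! ### Local orthogonality -/

theorem sum_outcomeOp_one_unitEffect_le {ι : Type*} (hfin : S.IsFiniteDimensional)
    (hself : S.SelfCompatibility) {G : ι → Obs}
    (hG : Pairwise fun j j' => S.outcomeOp (G j) 0 * S.outcomeOp (G j') 1 = S.outcomeOp (G j') 1)
    (s : Finset ι) : ∑ j ∈ s, S.outcomeOp (G j) 1 S.unitEffect ≤ S.unitEffect := by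
  classical
  induction s using Finset.induction_on with
  | empty => exact fun ρ => Set.indicator_nonneg (fun _ _ => zero_le_one) ρ
  | insert i s hi ih =>
    have hundisturbed : ∑ j ∈ s, S.outcomeOp (G j) 1 S.unitEffect =
        S.outcomeOp (G i) 0 (∑ j ∈ s, S.outcomeOp (G j) 1 S.unitEffect) := by
      rw [map_sum]
      refine Finset.sum_congr rfl fun j hj => ?_
      exact congr($((hG (ne_of_mem_of_not_mem hj hi).symm).symm) S.unitEffect)
    calc ∑ j ∈ insert i s, S.outcomeOp (G j) 1 S.unitEffect
        = S.outcomeOp (G i) 1 S.unitEffect +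
            S.outcomeOp (G i) 0 (∑ j ∈ s, S.outcomeOp (G j) 1 S.unitEffect) := by
          rw [Finset.sum_insert hi, ← hundisturbed]
      _ ≤ S.outcomeOp (G i) 1 S.unitEffect + S.outcomeOp (G i) 0 S.unitEffect := by
          gcongr
          exact outcomeOp_mono _ _ ih
      _ ≤ S.unitEffect := outcomeOp_unitEffect_add_le hfin hself _ one_ne_zero

end

end PhysicalSystem

open PhysicalSystem in
theorem mainTheorem8_general {Obs State ι : Type*} [Fintype ι] (S : PhysicalSystem Obs State)
    (hfin : S.IsFiniteDimensional) (hsubj : S.SubjectiveUpdate) (hself : S.SelfCompatibility)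
    (hfun : S.HasFunctionalCalculus) (hcompat : S.Compatibility) (hcomm : S.Commutativity)
    {m : ℕ} (A : ι → Fin m → Obs) (α : ι → Fin m → ℝ)
    (hA : ∀ j i i', i ≠ i' → S.Compatible (A j i) (A j i'))
    (hdist : ∀ j j', j ≠ j' → ∃ i, A j i = A j' i ∧ α j i ≠ α j' i)
    (ρ : State) (hρ : ρ ≠ S.null) :
    ∑ j, S.jointProb ρ (α j) (A j) ≤ 1 := by
  have hA' (j : ι) (i i' : Fin m) : S.Compatible (A j i) (A j i') := by
    obtain rfl | hne := eq_or_ne i i'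
    exacts [.refl _, hA j i i' hne]
  choose G hG using fun j => exists_isConjunction (α j) hfin hsubj hself hfun hcompat hcomm (hA' j)
  have hundisturbed : Pairwise fun j j' =>
      S.outcomeOp (G j) 0 * S.outcomeOp (G j') 1 = S.outcomeOp (G j') 1 := by
    intro j j' hjj'
    obtain ⟨i, hAi, hαi⟩ := hdist j j' hjj'
    exact (hG j).outcomeOp_zero_mul_one hfin hself hfun hcompat (hG j') (hA' j · i) hAi hαi
  calc ∑ j, S.jointProb ρ (α j) (A j)
      = (∑ j, S.outcomeOp (G j) 1 S.unitEffect) ρ := by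
        simp only [Finset.sum_apply, outcomeOp_unitEffect hfin hself, (hG _).real_prob_one ρ hρ]
    _ ≤ S.unitEffect ρ := sum_outcomeOp_one_unitEffect_le hfin hself hundisturbed _ ρ
    _ = 1 := unitEffect_of_ne_null hρ

theorem mainTheorem8 {Obs State : Type*} (S : PhysicalSystem Obs State)
    (hfin : S.IsFiniteDimensional)
    (hsep : S.Separability) (hsubj : S.SubjectiveUpdate) (hself : S.SelfCompatibility)
    (hobs : S.ObservablesAndStates) (hcompat : S.Compatibility) (hcomm : S.Commutativity)
    (heig : S.Eigenstates) (htrans : S.TransitionSymmetry)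
    {k m : ℕ} (A : Fin k → Fin m → Obs) (α : Fin k → Fin m → ℝ)
    (hA : ∀ j i i', i ≠ i' → S.Compatible (A j i) (A j i'))
    (hα : ∀ j i, α j i ∈ S.spectrum (A j i))
    (hdist : ∀ j j', j ≠ j' → ∃ i, A j i = A j' i ∧ α j i ≠ α j' i)
    (ρ : State) (hρ : ρ ≠ S.null) :
    ∑ j, S.jointProb ρ (α j) (A j) ≤ 1 := by
  exact mainTheorem8_general S hfin hsubj hself (hobs.hasFunctionalCalculus hfin) hcompat hcomm A α
    hA hdist ρ hρ
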